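/- Call a profinite group $\Gamma$ *axiomatizable* if every profinite group $\Lambda$ that satisfies exactly the same first-order sentences in the language of groups as $\Gamma$ is isomorphic to $\Gamma$ as a topological group. Call $\Gamma$ *small* if for every positive integer $n$ it has only finitely many open subgroups of index $n$. For an odd prime $p$ let $D_p$ be the dihedral group of order $2p$ with the discrete topology, and let $G=\prod_{p} D_p$ be the direct product over all odd primes $p$, with the product topology. **Theorem.** The profinite group $G$ is axiomatizable. Moreover, $G$ has infinitely many open subgroups of index $2$, so $G$ is not small. Consequently, not every axiomatizable profinite group is small. -/

import Mathlib

universe u v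

/-- Function symbols of the language of groups: multiplication, inversion, identity. -/
inductive GroupFunc : ℕ → Type
  | mul : GroupFunc 2
  | inv : GroupFunc 1
  | one : GroupFunc 0

/-- The first-order language of groups `(·, ⁻¹, 1)`, without relation symbols
(equality is part of first-order logic). -/
def groupLanguage : FirstOrder.Language.{0, 0} where
  Functions := GroupFunc
  Relations := fun _ => Empty

/-- Every group is a structure for the language of groups in the standard way. -/
instance groupLanguageStructure (G : Type u) [Group G] : groupLanguage.Structure G where
  funMap := fun {n} (f : GroupFunc n) =>
    match n, f with
    | _, GroupFunc.mul => fun x => x 0 * x 1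
    | _, GroupFunc.inv => fun x => (x 0)⁻¹
    | _, GroupFunc.one => fun _ => 1
  RelMap := fun {_} r => Empty.elim r

/-- A profinite group `Γ` is axiomatizable if every profinite group `Δ` with the same
first-order theory (as abstract groups) is isomorphic to `Γ` as a topological group. -/
def IsAxiomatizable (Γ : ProfiniteGrp.{u}) : Prop :=
  ∀ Δ : ProfiniteGrp.{v},
    groupLanguage.ElementarilyEquivalent Γ Δ → Nonempty (Γ ≃ₜ* Δ)

/-- A profinite group is small if it has only finitely many open subgroups of index `n`,
for every positive integer `n`. -/
def IsSmallProfinite (Γ : ProfiniteGrp.{u}) : Prop :=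
  ∀ n : ℕ, 0 < n → {U : Subgroup Γ | IsOpen (U : Set Γ) ∧ U.index = n}.Finite

/-- The index set of all odd primes. -/
abbrev OddPrime : Type := {p : ℕ // p.Prime ∧ Odd p}

instance oddPrimeNeZero (p : OddPrime) : NeZero (p : ℕ) := ⟨p.2.1.ne_zero⟩

/-- The direct product, over all odd primes `p`, of the dihedral groups of order `2p`
(each with the discrete topology), with the product topology. -/
noncomputable def dihedralProduct : ProfiniteGrp.{0} :=
  ProfiniteGrp.pi fun p : OddPrime =>
    ProfiniteGrp.ofFiniteGrp (FiniteGrp.of (DihedralGroup (p : ℕ)))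

/-! In `∏ D_p` the squares are exactly the families of rotations. An element commutes with all
squares of order dividing `p` iff its `p`-coordinate is a rotation, and the `p`-th powers of such
elements form the kernel `K_p` of the projection to `D_p`. So `K_p` is definable without parameters
(`InComplement`), and so are the statements that it has a direct complement `D_p` and that its
centralizer lies in `K_q` for `q ≠ p`.

In a profinite model, compactness makes `K_p` closed, so the maps to `D_p` are continuous. The
combined map to `∏ D_p` is surjective by compactness (`surjective_projection`). For injectivity, let
`x` lie in every `K_p`. Its commutator with a square is a `p`-th power of a square for every odd
`p`; the axioms then make it infinitely divisible, hence trivial in a profinite group. So `x`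
centralizes the squares, is itself a square, and dies by the same divisibility argument.

Pulling back the rotations from each factor gives infinitely many open subgroups of index 2. -/

open FirstOrder FirstOrder.Language

/-! ### First-order definability, uniform over all groups -/

/-- A family of functions `Gⁿ → G`, over all groups `G`, given by a term. -/
def IsTermDefinable (n : ℕ) (t : ∀ (G : Type v) [Group G], (Fin n → G) → G) : Prop :=
  ∃ τ : groupLanguage.Term (Empty ⊕ Fin n), ∀ (G : Type v) [Group G] (w : Fin n → G),
    τ.realize (Sum.elim Empty.elim w) = t G w

/-- A family of predicates on `Gⁿ`, over all groups `G`, given by a first-order formula. -/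
def IsFirstOrder (n : ℕ) (P : ∀ (G : Type v) [Group G], (Fin n → G) → Prop) : Prop :=
  ∃ φ : groupLanguage.BoundedFormula Empty n, ∀ (G : Type v) [Group G] (w : Fin n → G),
    φ.Realize Empty.elim w ↔ P G w

namespace IsTermDefinable

variable {n : ℕ} {s t : ∀ (G : Type v) [Group G], (Fin n → G) → G}

theorem var (i : Fin n) : IsTermDefinable.{v} n fun _ _ w => w i :=
  ⟨Term.var (Sum.inr i), fun _ _ _ => rfl⟩

theorem one : IsTermDefinable.{v} n fun _ _ _ => 1 :=
  ⟨Term.func (L := groupLanguage) GroupFunc.one Fin.elim0, fun _ _ _ => rfl⟩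

theorem inv (ht : IsTermDefinable n t) : IsTermDefinable n fun G _ w => (t G w)⁻¹ := by
  obtain ⟨τ, hτ⟩ := ht
  exact ⟨Term.func (L := groupLanguage) GroupFunc.inv fun _ => τ, fun G _ w =>
    congrArg (·⁻¹) (hτ G w)⟩

theorem mul (hs : IsTermDefinable n s) (ht : IsTermDefinable n t) :
    IsTermDefinable n fun G _ w => s G w * t G w := by
  obtain ⟨σ, hσ⟩ := hs
  obtain ⟨τ, hτ⟩ := ht
  exact ⟨Term.func (L := groupLanguage) GroupFunc.mul ![σ, τ], fun G _ w =>
    congrArg₂ (· * ·) (hσ G w) (hτ G w)⟩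

theorem pow (ht : IsTermDefinable n t) (k : ℕ) : IsTermDefinable n fun G _ w => t G w ^ k := by
  induction k with
  | zero => simpa only [pow_zero] using one
  | succ k ih => simpa only [pow_succ] using ih.mul ht

theorem lift (ht : IsTermDefinable n t) :
    IsTermDefinable (n + 1) fun G _ w => t G fun i => w i.castSucc := by
  obtain ⟨τ, hτ⟩ := ht
  refine ⟨τ.relabel (Sum.map id Fin.castSucc), fun G _ w => ?_⟩
  rw [Term.realize_relabel]
  refine Eq.trans ?_ (hτ G _)
  congr 1
  ext (i | i)
  · exact i.elim
  · rfl

end IsTermDefinable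

namespace IsFirstOrder

variable {n : ℕ} {P Q : ∀ (G : Type v) [Group G], (Fin n → G) → Prop}

theorem eq {s t : ∀ (G : Type v) [Group G], (Fin n → G) → G}
    (hs : IsTermDefinable n s) (ht : IsTermDefinable n t) :
    IsFirstOrder n fun G _ w => s G w = t G w := by
  obtain ⟨σ, hσ⟩ := hs
  obtain ⟨τ, hτ⟩ := ht
  exact ⟨σ.bdEqual τ, fun G _ w => by rw [BoundedFormula.realize_bdEqual, hσ, hτ]⟩

theorem imp (hP : IsFirstOrder n P) (hQ : IsFirstOrder n Q) :
    IsFirstOrder n fun G _ w => P G w → Q G w := by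
  obtain ⟨φ, hφ⟩ := hP
  obtain ⟨ψ, hψ⟩ := hQ
  exact ⟨φ.imp ψ, fun G _ w => by rw [BoundedFormula.realize_imp, hφ, hψ]⟩

theorem and (hP : IsFirstOrder n P) (hQ : IsFirstOrder n Q) :
    IsFirstOrder n fun G _ w => P G w ∧ Q G w := by
  obtain ⟨φ, hφ⟩ := hP
  obtain ⟨ψ, hψ⟩ := hQ
  exact ⟨φ ⊓ ψ, fun G _ w => by rw [BoundedFormula.realize_inf, hφ, hψ]⟩

/-- Covers conditions that do not involve `G`, such as `c = 1` inside `D_p`. -/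
theorem const (a : Prop) : IsFirstOrder.{v} n fun _ _ _ => a := by
  by_cases h : a
  · exact ⟨⊤, fun G _ w => by simp [h]⟩
  · exact ⟨⊥, fun G _ w => by simp [h]⟩

theorem all {R : ∀ (G : Type v) [Group G], (Fin n → G) → G → Prop}
    (hR : IsFirstOrder (n + 1) fun G _ w => R G (fun i => w i.castSucc) (w (Fin.last n))) :
    IsFirstOrder n fun G _ w => ∀ x, R G w x := by
  obtain ⟨φ, hφ⟩ := hR
  refine ⟨φ.all, fun G _ w => ?_⟩
  simp only [BoundedFormula.realize_all, hφ, Fin.snoc_castSucc, Fin.snoc_last]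

theorem ex {R : ∀ (G : Type v) [Group G], (Fin n → G) → G → Prop}
    (hR : IsFirstOrder (n + 1) fun G _ w => R G (fun i => w i.castSucc) (w (Fin.last n))) :
    IsFirstOrder n fun G _ w => ∃ x, R G w x := by
  obtain ⟨φ, hφ⟩ := hR
  refine ⟨φ.ex, fun G _ w => ?_⟩
  simp only [BoundedFormula.realize_ex, hφ, Fin.snoc_castSucc, Fin.snoc_last]

theorem finite_all {ι : Type*} [Finite ι] {R : ι → ∀ (G : Type v) [Group G], (Fin n → G) → Prop}
    (hR : ∀ i, IsFirstOrder n (R i)) : IsFirstOrder n fun G _ w => ∀ i, R i G w := by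
  choose φ hφ using hR
  exact ⟨BoundedFormula.iInf φ, fun G _ w => by simp only [BoundedFormula.realize_iInf, hφ]⟩

theorem finite_ex {ι : Type*} [Finite ι] {R : ι → ∀ (G : Type v) [Group G], (Fin n → G) → Prop}
    (hR : ∀ i, IsFirstOrder n (R i)) : IsFirstOrder n fun G _ w => ∃ i, R i G w := by
  choose φ hφ using hR
  exact ⟨BoundedFormula.iSup φ, fun G _ w => by simp only [BoundedFormula.realize_iSup, hφ]⟩

/-- A function on a finite set is a finite tuple, so quantifying over it is a block of first-order
existentials. -/
theorem ex_family {ι : Type*} [Finite ι] {R : ∀ (G : Type v) [Group G], (ι → G) → Prop}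
    (hR : ∀ (n : ℕ) (e : ι → Fin n), IsFirstOrder n fun G _ w => R G fun i => w (e i)) :
    IsFirstOrder.{v} 0 fun G _ _ => ∃ d : ι → G, R G d := by
  obtain ⟨n, ⟨e⟩⟩ := Finite.exists_equiv_fin ι
  obtain ⟨φ, hφ⟩ := hR n e
  refine ⟨φ.exs, fun G _ w => ?_⟩
  have h := BoundedFormula.realize_exs (φ := φ) (v := (Empty.elim : Empty → G))
  rw [Formula.Realize, Subsingleton.elim default w] at h
  rw [h]
  simp only [hφ]
  exact ⟨fun ⟨xs, h⟩ => ⟨_, h⟩, fun ⟨d, h⟩ => ⟨fun i => d (e.symm i), by simpa using h⟩⟩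

/-- Elementarily equivalent groups, possibly in different universes, agree on a first-order
property. -/
theorem transfer {P : ∀ (G : Type v) [Group G], Prop} (hP : IsFirstOrder 0 fun G _ _ => P G)
    {G : Type u} {H : Type v} [Group G] [Group H]
    (h : groupLanguage.ElementarilyEquivalent G H)
    {G' : Type v} [Group G'] (e : G ≃* G') (hG : P G') : P H := by
  obtain ⟨φ, hφ⟩ := hP
  let e' : groupLanguage.Equiv G G' :=
    { e.toEquiv with
      map_fun' := fun {n} f x => by
        cases f with
        | mul => exact map_mul e _ _
        | inv => exact map_inv e _
        | one => exact map_one e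
      map_rel' := fun r _ => r.elim }
  have key (M : Type v) [Group M] : Sentence.Realize M φ ↔ P M := by
    refine Iff.trans ?_ (hφ M default)
    exact iff_of_eq (congrArg (fun v => BoundedFormula.Realize φ v default)
      (Subsingleton.elim _ _))
  rw [← key]
  have h1 := (StrongHomClass.realize_sentence e' φ).2 ((key G').2 hG)
  exact (h.realize_sentence φ).1 h1

end IsFirstOrder

/-! ### The axioms and their first-order expressibility -/

/-- `g` commutes with every square of order dividing `p`. -/
def CentralizesTorsion (p : ℕ) {G : Type v} [Group G] (g : G) : Prop :=
  ∀ x : G, IsSquare x → x ^ p = 1 → g * x = x * g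

/-- `g` is the `p`-th power of an element commuting with all squares of order dividing `p`. -/
def InComplement (p : ℕ) {G : Type v} [Group G] (g : G) : Prop :=
  ∃ h : G, CentralizesTorsion p h ∧ g = h ^ p

/-- First-order properties of a group expressing that the squares form an abelian subgroup equal
to its own centralizer, every element of which is the square of a square. -/
structure SquaresSelfCentralizing (G : Type v) [Group G] : Prop where
  mul : ∀ x y : G, IsSquare x → IsSquare y → IsSquare (x * y)
  comm : ∀ x y : G, IsSquare x → IsSquare y → x * y = y * x
  root : ∀ x : G, IsSquare x → ∃ y : G, IsSquare y ∧ x = y * y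
  isSquare : ∀ g : G, (∀ x : G, IsSquare x → g * x = x * g) → IsSquare g

/-- First-order properties of the `p`-torsion and of the `p`-th powers of the squares. -/
structure SquaresSplitAt (p : ℕ) (G : Type v) [Group G] : Prop where
  split : ∀ x : G, IsSquare x → ∃ y z : G, (IsSquare y ∧ y ^ p = 1) ∧ IsSquare z ∧ x = y * z ^ p
  pow_pow : ∀ z : G, IsSquare z → ∃ w : G, IsSquare w ∧ z ^ p = (w ^ p) ^ p
  inComplement : ∀ g : G, InComplement p g → IsSquare g → ∃ z : G, IsSquare z ∧ g = z ^ p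

/-- The family `d` is a copy of `D_p` which is a direct complement of the elements satisfying
`InComplement p`. -/
structure IsDihedralFactor (p : ℕ) (G : Type v) [Group G] (d : DihedralGroup p → G) : Prop where
  map_mul : ∀ c c', d (c * c') = d c * d c'
  comm : ∀ c, ∀ k : G, InComplement p k → d c * k = k * d c
  cover : ∀ g : G, ∃ c, InComplement p ((d c)⁻¹ * g)
  eq_one : ∀ c, InComplement p (d c) → c = 1

/-- The elements satisfying `InComplement p` are closed under multiplication. -/
def ComplementMul (p : ℕ) (G : Type v) [Group G] : Prop :=
  ∀ x y : G, InComplement p x → InComplement p y → InComplement p (x * y)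

/-- The centralizer of the complement at `p` is contained in the complement at `q`. -/
def CentralizerLE (p q : ℕ) (G : Type v) [Group G] : Prop :=
  ∀ x : G, (∀ k : G, InComplement p k → x * k = k * x) → InComplement q x

namespace IsFirstOrder

variable {n : ℕ} {t : ∀ (G : Type v) [Group G], (Fin n → G) → G}

theorem isSquare (ht : IsTermDefinable n t) : IsFirstOrder n fun G _ w => IsSquare (t G w) :=
  ex (R := fun G _ w x => t G w = x * x) (eq ht.lift ((IsTermDefinable.var _).mul (.var _)))

theorem centralizesTorsion (p : ℕ) (ht : IsTermDefinable n t) :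
    IsFirstOrder n fun G _ w => CentralizesTorsion p (t G w) :=
  all (R := fun G _ w x => IsSquare x → x ^ p = 1 → t G w * x = x * t G w)
    ((isSquare (.var _)).imp ((eq ((IsTermDefinable.var _).pow p) .one).imp
      (eq (ht.lift.mul (.var _)) ((IsTermDefinable.var _).mul ht.lift))))

theorem inComplement (p : ℕ) (ht : IsTermDefinable n t) :
    IsFirstOrder n fun G _ w => InComplement p (t G w) :=
  ex (R := fun G _ w h => CentralizesTorsion p h ∧ t G w = h ^ p)
    ((centralizesTorsion p (.var _)).and (eq ht.lift ((IsTermDefinable.var _).pow p)))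

theorem congr {P Q : ∀ (G : Type v) [Group G], (Fin n → G) → Prop} (hP : IsFirstOrder n P)
    (h : ∀ (G : Type v) [Group G] (w : Fin n → G), P G w ↔ Q G w) : IsFirstOrder n Q := by
  obtain ⟨φ, hφ⟩ := hP
  exact ⟨φ, fun G _ w => (hφ G w).trans (h G w)⟩

theorem squaresSelfCentralizing :
    IsFirstOrder.{v} 0 fun G _ _ => SquaresSelfCentralizing G := by
  refine congr (P := fun G _ _ =>
    (∀ x y : G, IsSquare x → IsSquare y → IsSquare (x * y)) ∧
    (∀ x y : G, IsSquare x → IsSquare y → x * y = y * x) ∧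
    (∀ x : G, IsSquare x → ∃ y : G, IsSquare y ∧ x = y * y) ∧
    (∀ g : G, (∀ x : G, IsSquare x → g * x = x * g) → IsSquare g)) ?_
    fun G _ _ => ⟨fun ⟨a, b, c, d⟩ => ⟨a, b, c, d⟩, fun ⟨a, b, c, d⟩ => ⟨a, b, c, d⟩⟩
  repeat' first
    | exact IsTermDefinable.var _
    | apply IsTermDefinable.mul
    | apply and
    | apply isSquare
    | apply eq
    | apply ex
    | apply all
    | apply imp

theorem squaresSplitAt (p : ℕ) : IsFirstOrder.{v} 0 fun G _ _ => SquaresSplitAt p G := by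
  refine congr (P := fun G _ _ =>
    (∀ x : G, IsSquare x → ∃ y z : G, (IsSquare y ∧ y ^ p = 1) ∧ IsSquare z ∧ x = y * z ^ p) ∧
    (∀ z : G, IsSquare z → ∃ w : G, IsSquare w ∧ z ^ p = (w ^ p) ^ p) ∧
    (∀ g : G, InComplement p g → IsSquare g → ∃ z : G, IsSquare z ∧ g = z ^ p)) ?_
    fun G _ _ => ⟨fun ⟨a, b, c⟩ => ⟨a, b, c⟩, fun ⟨a, b, c⟩ => ⟨a, b, c⟩⟩
  repeat' first
    | exact IsTermDefinable.var _
    | exact IsTermDefinable.one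
    | apply IsTermDefinable.mul
    | apply IsTermDefinable.pow
    | apply and
    | apply isSquare
    | apply inComplement
    | apply eq
    | apply ex
    | apply all
    | apply imp

theorem isDihedralFactor (p : ℕ) [NeZero p] :
    IsFirstOrder.{v} 0 fun G _ _ => ∃ d, IsDihedralFactor p G d := by
  refine ex_family fun n e => ?_
  refine congr (P := fun G _ w =>
    (∀ c c', w (e (c * c')) = w (e c) * w (e c')) ∧
    (∀ c, ∀ k : G, InComplement p k → w (e c) * k = k * w (e c)) ∧
    (∀ g : G, ∃ c, InComplement p ((w (e c))⁻¹ * g)) ∧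
    (∀ c, InComplement p (w (e c)) → c = 1)) ?_
    fun G _ _ => ⟨fun ⟨a, b, c, d⟩ => ⟨a, b, c, d⟩, fun ⟨a, b, c, d⟩ => ⟨a, b, c, d⟩⟩
  refine .and ?_ (.and ?_ (.and ?_ ?_))
  · exact finite_all fun c => finite_all fun c' => eq (.var _) ((IsTermDefinable.var _).mul (.var _))
  · exact finite_all fun c => all ((inComplement p (.var _)).imp
      (eq ((IsTermDefinable.var _).mul (.var _)) ((IsTermDefinable.var _).mul (.var _))))
  · exact all (finite_ex fun c => inComplement p ((IsTermDefinable.var _).inv.mul (.var _)))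
  · exact finite_all fun c => (inComplement p (.var _)).imp (const _)

theorem complementMul (p : ℕ) : IsFirstOrder.{v} 0 fun G _ _ => ComplementMul p G :=
  all (all ((inComplement p (.var _)).imp ((inComplement p (.var _)).imp
    (inComplement p ((IsTermDefinable.var _).mul (.var _))))))

theorem centralizerLE (p q : ℕ) : IsFirstOrder.{v} 0 fun G _ _ => CentralizerLE p q G :=
  all ((all ((inComplement p (.var _)).imp (eq ((IsTermDefinable.var _).mul (.var _))
    ((IsTermDefinable.var _).mul (.var _))))).imp (inComplement q (.var _)))

end IsFirstOrder

/-! ### Arithmetic in a single dihedral group -/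

namespace DihedralGroup

/-- The cyclic subgroup of rotations of the dihedral group. -/
def rotations (n : ℕ) : Subgroup (DihedralGroup n) where
  carrier := Set.range r
  mul_mem' := by rintro _ _ ⟨i, rfl⟩ ⟨j, rfl⟩; exact ⟨i + j, rfl⟩
  one_mem' := ⟨0, rfl⟩
  inv_mem' := by rintro _ ⟨i, rfl⟩; exact ⟨-i, rfl⟩

variable {n : ℕ}

theorem r_mem_rotations (i : ZMod n) : r i ∈ rotations n := ⟨i, rfl⟩

theorem sr_notMem_rotations (i : ZMod n) : sr i ∉ rotations n := by
  rintro ⟨j, hj⟩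
  cases hj

theorem index_rotations (n : ℕ) : (rotations n).index = 2 := by
  refine Subgroup.index_eq_two_iff.2 ⟨sr 0, ?_⟩
  rintro (i | i)
  · exact Or.inr ⟨r_mem_rotations _, sr_notMem_rotations _⟩
  · exact Or.inl ⟨r_mem_rotations _, sr_notMem_rotations _⟩

theorem isSquare_mem_rotations {c : DihedralGroup n} (hc : IsSquare c) : c ∈ rotations n := by
  obtain ⟨i | i, rfl⟩ := hc
  · exact r_mem_rotations _
  · exact r_mem_rotations _

theorem commute_of_mem_rotations {c d : DihedralGroup n} (hc : c ∈ rotations n)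
    (hd : d ∈ rotations n) : c * d = d * c := by
  obtain ⟨i, rfl⟩ := hc
  obtain ⟨j, rfl⟩ := hd
  simp [add_comm]

theorem pow_eq_one_of_mem_rotations {c : DihedralGroup n} (hc : c ∈ rotations n) : c ^ n = 1 := by
  obtain ⟨i, rfl⟩ := hc
  simp

theorem two_ne_zero_of_odd_prime (hn : n.Prime) (hodd : Odd n) : (2 : ZMod n) ≠ 0 := by
  intro h
  have h2 : ((2 : ℕ) : ZMod n) = 0 := by exact_mod_cast h
  rw [ZMod.natCast_eq_zero_iff, Nat.prime_dvd_prime_iff_eq hn Nat.prime_two] at h2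
  subst h2
  exact absurd hodd (by decide)

theorem exists_mul_self_of_mem_rotations (hn : n.Prime) (hodd : Odd n) {c : DihedralGroup n}
    (hc : c ∈ rotations n) : ∃ d ∈ rotations n, c = d * d := by
  have := Fact.mk hn
  obtain ⟨i, rfl⟩ := hc
  have := two_ne_zero_of_odd_prime hn hodd
  exact ⟨r (i / 2), r_mem_rotations _, by rw [r_mul_r]; congr 1; field_simp; ring⟩

theorem mem_rotations_of_commute_r_one (hn : n.Prime) (hodd : Odd n) {c : DihedralGroup n}
    (hc : c * r 1 = r 1 * c) : c ∈ rotations n := by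
  rcases c with i | i
  · exact r_mem_rotations _
  · exfalso
    simp only [sr_mul_r, r_mul_sr, sr.injEq] at hc
    exact two_ne_zero_of_odd_prime hn hodd (by linear_combination hc)

theorem eq_one_of_forall_commute (hn : n.Prime) (hodd : Odd n) {c : DihedralGroup n}
    (hc : ∀ d, c * d = d * c) : c = 1 := by
  have := Fact.mk hn
  obtain ⟨i, rfl⟩ := mem_rotations_of_commute_r_one hn hodd (hc _)
  have h := hc (sr 0)
  simp only [sr_mul_r, r_mul_sr, sr.injEq] at h
  have h2 : (2 : ZMod n) * i = 0 := by linear_combination -h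
  rw [(mul_eq_zero.1 h2).resolve_left (two_ne_zero_of_odd_prime hn hodd), r_zero]

theorem natCast_ne_zero_of_prime_of_ne {p : ℕ} (hn : n.Prime) (hp : p.Prime) (h : p ≠ n) :
    (p : ZMod n) ≠ 0 := by
  rw [Ne, ZMod.natCast_eq_zero_iff, Nat.prime_dvd_prime_iff_eq hn hp]
  exact h.symm

theorem eq_one_of_mem_rotations_of_pow_eq_one {p : ℕ} (hn : n.Prime) (hp : p.Prime) (h : p ≠ n)
    {c : DihedralGroup n} (hc : c ∈ rotations n) (hcp : c ^ p = 1) : c = 1 := by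
  have := Fact.mk hn
  obtain ⟨i, rfl⟩ := hc
  rw [r_pow, ← r_zero, r.injEq] at hcp
  rw [(mul_eq_zero.1 hcp).resolve_right (natCast_ne_zero_of_prime_of_ne hn hp h), r_zero]

/-- `p` is invertible modulo `n`, which handles rotations; a reflection is its own odd power. -/
theorem exists_pow_eq {p : ℕ} (hn : n.Prime) (hp : p.Prime) (hodd : Odd p) (h : p ≠ n)
    (c : DihedralGroup n) : ∃ d, d ^ p = c ∧ (c ∈ rotations n → d ∈ rotations n) := by
  have := Fact.mk hn
  have := natCast_ne_zero_of_prime_of_ne hn hp h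
  rcases c with i | i
  · exact ⟨r (i / p), by rw [r_pow]; congr 1; field_simp, fun _ => r_mem_rotations _⟩
  · refine ⟨sr i, ?_, id⟩
    obtain ⟨k, rfl⟩ := hodd
    rw [pow_succ, pow_mul, sq, sr_mul_self, one_pow, one_mul]

end DihedralGroup

/-! ### The product of the `D_q` satisfies the axioms -/

open DihedralGroup

/-- The homomorphisms `π q` identify `M` with the product of the groups `D_q`. -/
structure IsDihedralProduct {M : Type v} [Group M]
    (π : ∀ q : OddPrime, M →* DihedralGroup (q : ℕ)) : Prop where
  ext : ∀ {x y : M}, (∀ q, π q x = π q y) → x = y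
  exists_eq : ∀ f : ∀ q : OddPrime, DihedralGroup (q : ℕ), ∃ x, ∀ q, π q x = f q

namespace IsDihedralProduct

variable {M : Type v} [Group M] {π : ∀ q : OddPrime, M →* DihedralGroup (q : ℕ)}

theorem exists_single (h : IsDihedralProduct π) (p : OddPrime) (c : DihedralGroup (p : ℕ)) :
    ∃ x, π p x = c ∧ ∀ q, q ≠ p → π q x = 1 := by
  classical
  obtain ⟨x, hx⟩ := h.exists_eq (Pi.mulSingle p c)
  exact ⟨x, by simp [hx], fun q hq => by simp [hx, hq]⟩

theorem exists_mul_self (h : IsDihedralProduct π) {x : M}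
    (hx : ∀ q : OddPrime, π q x ∈ rotations (q : ℕ)) :
    ∃ y, (∀ q : OddPrime, π q y ∈ rotations (q : ℕ)) ∧ x = y * y := by
  choose f hfr hf using fun q : OddPrime => exists_mul_self_of_mem_rotations q.2.1 q.2.2 (hx q)
  obtain ⟨y, hy⟩ := h.exists_eq f
  exact ⟨y, fun q => hy q ▸ hfr q, h.ext fun q => by rw [map_mul, hy, hf]⟩

theorem isSquare_iff (h : IsDihedralProduct π) {x : M} :
    IsSquare x ↔ ∀ q : OddPrime, π q x ∈ rotations (q : ℕ) := by
  refine ⟨fun hx q => isSquare_mem_rotations (hx.map (π q)), fun hx => ?_⟩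
  obtain ⟨y, -, hy⟩ := h.exists_mul_self hx
  exact ⟨y, hy⟩

/-- Roots are taken coordinatewise, with 1 at `p`. The last clause makes the root of a square a
square. -/
theorem exists_root (h : IsDihedralProduct π) (p : OddPrime) {x : M} (hx : π p x = 1) :
    ∃ y, y ^ (p : ℕ) = x ∧ π p y = 1 ∧
      ∀ q : OddPrime, π q x ∈ rotations (q : ℕ) → π q y ∈ rotations (q : ℕ) := by
  have key (q : OddPrime) : ∃ d : DihedralGroup (q : ℕ), d ^ (p : ℕ) = π q x ∧ (q = p → d = 1) ∧
      (π q x ∈ rotations (q : ℕ) → d ∈ rotations (q : ℕ)) := by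
    rcases eq_or_ne q p with rfl | hqp
    · exact ⟨1, by rw [hx, one_pow], fun _ => rfl, fun _ => one_mem _⟩
    · obtain ⟨d, hd, hd'⟩ := exists_pow_eq q.2.1 p.2.1 p.2.2
        (fun hpq => hqp (Subtype.ext hpq.symm)) (π q x)
      exact ⟨d, hd, fun e => absurd e hqp, hd'⟩
  choose f hf hf1 hfr using key
  obtain ⟨y, hy⟩ := h.exists_eq f
  exact ⟨y, h.ext fun q => by rw [map_pow, hy, hf], by rw [hy, hf1 p rfl],
    fun q hq => by rw [hy]; exact hfr q hq⟩

/-- Squares killed by `p` are rotations at `p` and trivial elsewhere, so only the coordinate at `p`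
matters; there a reflection does not commute with `r 1`. -/
theorem centralizesTorsion_iff (h : IsDihedralProduct π) (p : OddPrime) {g : M} :
    CentralizesTorsion p g ↔ π p g ∈ rotations (p : ℕ) := by
  constructor
  · intro hg
    obtain ⟨x, hx, hx'⟩ := h.exists_single p (r 1)
    have hsq : IsSquare x := h.isSquare_iff.2 fun q => by
      rcases eq_or_ne q p with rfl | hq
      · exact hx ▸ r_mem_rotations 1
      · exact hx' q hq ▸ one_mem _
    have hpow : x ^ (p : ℕ) = 1 := h.ext fun q => by
      rw [map_pow, map_one]
      rcases eq_or_ne q p with rfl | hq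
      · rw [hx]; exact pow_eq_one_of_mem_rotations (r_mem_rotations 1)
      · rw [hx' q hq, one_pow]
    have := congrArg (π p) (hg x hsq hpow)
    rw [map_mul, map_mul, hx] at this
    exact mem_rotations_of_commute_r_one p.2.1 p.2.2 this
  · intro hg x hx hxp
    refine h.ext fun q => ?_
    rw [map_mul, map_mul]
    rcases eq_or_ne q p with rfl | hq
    · exact commute_of_mem_rotations hg (h.isSquare_iff.1 hx _)
    · have : π q x = 1 := eq_one_of_mem_rotations_of_pow_eq_one q.2.1 p.2.1
        (fun e => hq (Subtype.ext e.symm)) (h.isSquare_iff.1 hx q)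
        (by rw [← map_pow, hxp, map_one])
      rw [this, one_mul, mul_one]

theorem inComplement_iff (h : IsDihedralProduct π) (p : OddPrime) {g : M} :
    InComplement p g ↔ π p g = 1 := by
  constructor
  · rintro ⟨x, hx, rfl⟩
    rw [map_pow]
    exact pow_eq_one_of_mem_rotations ((h.centralizesTorsion_iff p).1 hx)
  · intro hg
    obtain ⟨y, hy, hy1, -⟩ := h.exists_root p hg
    exact ⟨y, (h.centralizesTorsion_iff p).2 (hy1 ▸ one_mem _), hy.symm⟩

theorem squaresSelfCentralizing (h : IsDihedralProduct π) : SquaresSelfCentralizing M where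
  mul x y hx hy := h.isSquare_iff.2 fun q => by
    rw [map_mul]
    exact mul_mem (h.isSquare_iff.1 hx q) (h.isSquare_iff.1 hy q)
  comm x y hx hy := h.ext fun q => by
    rw [map_mul, map_mul]
    exact commute_of_mem_rotations (h.isSquare_iff.1 hx q) (h.isSquare_iff.1 hy q)
  root x hx := by
    obtain ⟨y, hy, hxy⟩ := h.exists_mul_self (h.isSquare_iff.1 hx)
    exact ⟨y, h.isSquare_iff.2 hy, hxy⟩
  isSquare g hg := h.isSquare_iff.2 fun q => (h.centralizesTorsion_iff q).1 fun x hx _ => hg x hx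

theorem squaresSplitAt (h : IsDihedralProduct π) (p : OddPrime) : SquaresSplitAt p M where
  split x hx := by
    have hx' := h.isSquare_iff.1 hx
    obtain ⟨y, hy, hy'⟩ := h.exists_single p (π p x)
    have hyr (q : OddPrime) : π q y ∈ rotations (q : ℕ) := by
      rcases eq_or_ne q p with rfl | hq
      · exact hy ▸ hx' _
      · exact hy' q hq ▸ one_mem _
    obtain ⟨z, hz, -, hzr⟩ := h.exists_root p (x := y⁻¹ * x) (by rw [map_mul, map_inv, hy]; simp)
    refine ⟨y, z, ⟨h.isSquare_iff.2 hyr, h.ext fun q => ?_⟩, h.isSquare_iff.2 fun q => hzr q ?_, ?_⟩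
    · rw [map_pow, map_one]
      rcases eq_or_ne q p with rfl | hq
      · exact pow_eq_one_of_mem_rotations (hyr _)
      · rw [hy' q hq, one_pow]
    · rw [map_mul, map_inv]
      exact mul_mem (inv_mem (hyr q)) (hx' q)
    · rw [hz, mul_inv_cancel_left]
  pow_pow z hz := by
    have hz' := h.isSquare_iff.1 hz
    have hp : π p (z ^ (p : ℕ)) = 1 := by rw [map_pow]; exact pow_eq_one_of_mem_rotations (hz' p)
    obtain ⟨y, hy, hy1, hyr⟩ := h.exists_root p hp
    obtain ⟨w, hw, -, hwr⟩ := h.exists_root p hy1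
    refine ⟨w, h.isSquare_iff.2 fun q => hwr q (hyr q ?_), by rw [hw, hy]⟩
    rw [map_pow]
    exact pow_mem (hz' q) _
  inComplement g hg hsq := by
    obtain ⟨y, hy, -, hyr⟩ := h.exists_root p ((h.inComplement_iff p).1 hg)
    exact ⟨y, h.isSquare_iff.2 fun q => hyr q (h.isSquare_iff.1 hsq q), hy.symm⟩

theorem exists_isDihedralFactor (h : IsDihedralProduct π) (p : OddPrime) :
    ∃ d, IsDihedralFactor p M d := by
  choose d hd hd' using h.exists_single p
  refine ⟨d, fun c c' => h.ext fun q => ?_, fun c k hk => h.ext fun q => ?_, fun g => ⟨π p g, ?_⟩,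
    fun c hc => ?_⟩
  · rw [map_mul]
    rcases eq_or_ne q p with rfl | hq
    · simp only [hd]
    · simp only [hd' _ q hq, one_mul]
  · rw [map_mul, map_mul]
    rcases eq_or_ne q p with rfl | hq
    · rw [(h.inComplement_iff q).1 hk, one_mul, mul_one]
    · simp only [hd' _ q hq, one_mul, mul_one]
  · rw [h.inComplement_iff, map_mul, map_inv, hd, inv_mul_cancel]
  · rw [← hd c]
    exact (h.inComplement_iff p).1 hc

theorem complementMul (h : IsDihedralProduct π) (p : OddPrime) : ComplementMul p M := by
  intro x y
  simp only [h.inComplement_iff, map_mul]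
  intro hx hy
  rw [hx, hy, one_mul]

/-- The kernel at `p` contains the factor `D_q`, whose centre is trivial. -/
theorem centralizerLE (h : IsDihedralProduct π) {p q : OddPrime} (hpq : q ≠ p) :
    CentralizerLE p q M := by
  intro x hx
  refine (h.inComplement_iff q).2 (eq_one_of_forall_commute q.2.1 q.2.2 fun c => ?_)
  obtain ⟨k, hk, hk'⟩ := h.exists_single q c
  have := congrArg (π q) (hx k ((h.inComplement_iff p).2 (hk' p hpq.symm)))
  rwa [map_mul, map_mul, hk] at this

end IsDihedralProduct

/-! ### The axiom system and its transfer -/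

/-- The conjunction of the first-order properties of the product of the groups `D_p` which
determine it among profinite groups. -/
structure DihedralAxioms (G : Type v) [Group G] : Prop where
  squares : SquaresSelfCentralizing G
  splitAt : ∀ p : OddPrime, SquaresSplitAt p G
  factor : ∀ p : OddPrime, ∃ d, IsDihedralFactor p G d
  complementMul : ∀ p : OddPrime, ComplementMul p G
  centralizerLE : ∀ p q : OddPrime, q ≠ p → CentralizerLE p q G

/-- The copy `G'` moves `G` into the universe of `H`, where the formulas are interpreted. -/
theorem DihedralAxioms.of_elementarilyEquivalent {G : Type u} {H : Type v} [Group G] [Group H]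
    {π : ∀ q : OddPrime, G →* DihedralGroup (q : ℕ)} (hπ : IsDihedralProduct π)
    {G' : Type v} [Group G'] (e : G ≃* G')
    (h : groupLanguage.ElementarilyEquivalent G H) : DihedralAxioms H := by
  have hM : IsDihedralProduct fun q => (π q).comp e.symm.toMonoidHom :=
    ⟨fun hxy => e.symm.injective (hπ.ext hxy), fun f => by
      obtain ⟨x, hx⟩ := hπ.exists_eq f
      exact ⟨e x, fun q => by simp [hx]⟩⟩
  exact
    { squares := IsFirstOrder.squaresSelfCentralizing.transfer h e hM.squaresSelfCentralizing
      splitAt := fun p => (IsFirstOrder.squaresSplitAt p).transfer h e (hM.squaresSplitAt p)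
      factor := fun p => (IsFirstOrder.isDihedralFactor p).transfer h e (hM.exists_isDihedralFactor p)
      complementMul := fun p => (IsFirstOrder.complementMul p).transfer h e (hM.complementMul p)
      centralizerLE := fun p q hpq =>
        (IsFirstOrder.centralizerLE p q).transfer h e (hM.centralizerLE hpq) }

/-! ### Dihedral quotients of a model -/

open DihedralGroup

section Group

variable {G : Type v} [Group G]

theorem InComplement.inv {p : ℕ} {g : G} (hg : InComplement p g) : InComplement p g⁻¹ := by
  obtain ⟨h, hh, rfl⟩ := hg
  refine ⟨h⁻¹, fun x hx hxp => ?_, (inv_pow h p).symm⟩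
  exact (Commute.inv_left (hh x hx hxp) : Commute h⁻¹ x)

theorem InComplement.one (p : ℕ) : InComplement p (1 : G) :=
  ⟨1, fun x _ _ => by rw [one_mul, mul_one], (one_pow p).symm⟩

variable {p : ℕ} {d : DihedralGroup p → G}

namespace IsDihedralFactor

theorem map_one (hd : IsDihedralFactor p G d) : d 1 = 1 := by
  have := hd.map_mul 1 1
  rwa [mul_one, left_eq_mul] at this

theorem map_inv (hd : IsDihedralFactor p G d) (c : DihedralGroup p) : d c⁻¹ = (d c)⁻¹ := by
  rw [eq_inv_iff_mul_eq_one, ← hd.map_mul, inv_mul_cancel, hd.map_one]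

theorem unique (hd : IsDihedralFactor p G d) (hp : ComplementMul p G) {g : G}
    {c c' : DihedralGroup p} (hc : InComplement p ((d c)⁻¹ * g))
    (hc' : InComplement p ((d c')⁻¹ * g)) : c = c' := by
  have h := hp _ _ hc hc'.inv
  rw [mul_inv_rev, inv_inv, mul_assoc, mul_inv_cancel_left, ← hd.map_inv, ← hd.map_mul] at h
  exact inv_mul_eq_one.1 (hd.eq_one _ h)

/-- The projection onto a dihedral factor. -/
noncomputable def proj (hd : IsDihedralFactor p G d) (hp : ComplementMul p G) :
    G →* DihedralGroup p where
  toFun g := (hd.cover g).choose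
  map_one' := hd.unique hp (hd.cover 1).choose_spec (by
    rw [hd.map_one, inv_one, one_mul]; exact .one p)
  map_mul' x y := hd.unique hp (hd.cover _).choose_spec (by
    have hx := (hd.cover x).choose_spec
    have hy := (hd.cover y).choose_spec
    set a := (hd.cover x).choose
    set b := (hd.cover y).choose
    -- The dihedral factor commutes with the complement, so `(d b)⁻¹` moves past `(d a)⁻¹ * x`.
    have key : (d (a * b))⁻¹ * (x * y) = ((d a)⁻¹ * x) * ((d b)⁻¹ * y) := by
      have := hd.comm b⁻¹ _ hx
      rw [hd.map_inv] at this
      rw [hd.map_mul, mul_inv_rev]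
      calc (d b)⁻¹ * (d a)⁻¹ * (x * y) = ((d b)⁻¹ * ((d a)⁻¹ * x)) * y := by group
        _ = _ := by rw [this]; group
    rw [key]
    exact hp _ _ hx hy)

theorem proj_eq_iff (hd : IsDihedralFactor p G d) (hp : ComplementMul p G) {g : G}
    {c : DihedralGroup p} : hd.proj hp g = c ↔ InComplement p ((d c)⁻¹ * g) := by
  refine ⟨fun h => ?_, fun h => hd.unique hp (hd.cover g).choose_spec h⟩
  subst h
  exact (hd.cover g).choose_spec

theorem proj_eq_one_iff (hd : IsDihedralFactor p G d) (hp : ComplementMul p G) {g : G} :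
    hd.proj hp g = 1 ↔ InComplement p g := by
  rw [hd.proj_eq_iff, hd.map_one, inv_one, one_mul]

theorem proj_apply (hd : IsDihedralFactor p G d) (hp : ComplementMul p G) (c : DihedralGroup p) :
    hd.proj hp (d c) = c := by
  rw [hd.proj_eq_iff, inv_mul_cancel]
  exact .one p

end IsDihedralFactor

namespace DihedralAxioms

/-- The homomorphism to the product of the groups `D_p` given by the projections onto the
dihedral factors. -/
noncomputable def projection (hG : DihedralAxioms G) :
    G →* ∀ p : OddPrime, DihedralGroup (p : ℕ) :=
  MonoidHom.pi fun p => (hG.factor p).choose_spec.proj (hG.complementMul p)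

/-- The copy of `D_p` centralizes the complement at `p`, so `centralizerLE` makes it trivial at
every `q ≠ p`; coordinates can therefore be adjusted one at a time. -/
theorem exists_projection_eq_on_finset (hG : DihedralAxioms G)
    (f : ∀ p : OddPrime, DihedralGroup (p : ℕ)) (s : Finset OddPrime) :
    ∃ g : G, (∀ p ∈ s, hG.projection g p = f p) ∧ ∀ p ∉ s, hG.projection g p = 1 := by
  classical
  induction s using Finset.induction_on with
  | empty => exact ⟨1, by simp, by simp⟩
  | insert p s hp ih =>
    obtain ⟨g, hg, hg'⟩ := ih
    have hd := (hG.factor p).choose_spec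
    let a : G := (hG.factor p).choose (f p)
    have ha : hG.projection a p = f p := hd.proj_apply (hG.complementMul p) (f p)
    have ha' (q : OddPrime) (hq : q ≠ p) : hG.projection a q = 1 :=
      ((hG.factor q).choose_spec.proj_eq_one_iff (hG.complementMul q)).2
        (hG.centralizerLE p q hq a (hd.comm (f p)))
    refine ⟨a * g, fun q hq => ?_, fun q hq => ?_⟩
    · rw [map_mul, Pi.mul_apply]
      rcases eq_or_ne q p with rfl | hqp
      · rw [ha, hg' q hp, mul_one]
      · rw [ha' q hqp, one_mul, hg q (Finset.mem_of_mem_insert_of_ne hq hqp)]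
    · rw [Finset.mem_insert, not_or] at hq
      rw [map_mul, Pi.mul_apply, ha' q hq.1, hg' q hq.2, one_mul]

end DihedralAxioms

end Group

/-! ### Profinite models: continuity, injectivity, surjectivity -/

section Profinite

variable {G : Type v} [Group G] [TopologicalSpace G] [IsTopologicalGroup G] [CompactSpace G]

/-- A centralizer is closed, hence compact, and so is its image under the `p`-th power map. -/
theorem isClosed_setOf_inComplement [T2Space G] (p : ℕ) :
    IsClosed {g : G | InComplement p g} := by
  have h : IsClosed {g : G | CentralizesTorsion p g} := by
    simp only [CentralizesTorsion, Set.ofPred_forall]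
    exact isClosed_iInter fun x => isClosed_iInter fun _ => isClosed_iInter fun _ =>
      isClosed_eq (by fun_prop) (by fun_prop)
  have h2 : {g : G | InComplement p g} = (fun g => g ^ p) '' {g : G | CentralizesTorsion p g} := by
    ext g
    exact exists_congr fun x => and_congr_right fun _ => eq_comm
  rw [h2]
  exact (h.isCompact.image (continuous_pow p)).isClosed

theorem IsDihedralFactor.isClosed_fiber [T2Space G] {p : ℕ} {d : DihedralGroup p → G}
    (hd : IsDihedralFactor p G d) (hp : ComplementMul p G) (c : DihedralGroup p) :
    IsClosed {g : G | hd.proj hp g = c} := by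
  simp only [hd.proj_eq_iff]
  exact (isClosed_setOf_inComplement p).preimage (continuous_const_mul _)

theorem IsDihedralFactor.isOpen_preimage [T2Space G] {p : ℕ} [NeZero p] {d : DihedralGroup p → G}
    (hd : IsDihedralFactor p G d) (hp : ComplementMul p G) (s : Set (DihedralGroup p)) :
    IsOpen (hd.proj hp ⁻¹' s) := by
  have h : hd.proj hp ⁻¹' s = (⋃ c ∈ sᶜ, {g : G | hd.proj hp g = c})ᶜ := by
    ext g
    simp only [Set.mem_preimage, Set.mem_compl_iff, Set.mem_iUnion, exists_prop, not_exists]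
    exact ⟨fun hg c ⟨hc, h⟩ => hc (Eq.subst (motive := (· ∈ s)) h hg),
      fun hg => by_contra fun hn => hg _ ⟨hn, rfl⟩⟩
  rw [h, isOpen_compl_iff]
  exact (Set.toFinite _).isClosed_biUnion fun c _ => hd.isClosed_fiber hp c

/-- An infinitely divisible element of a profinite group is trivial. -/
theorem eq_one_of_forall_exists_prime_pow [TotallyDisconnectedSpace G] {x : G}
    (h : ∀ p : ℕ, p.Prime → ∀ k : ℕ, ∃ z : G, x = z ^ p ^ k) : x = 1 := by
  by_contra hx
  obtain ⟨U, hU⟩ := ProfiniteGrp.exist_openNormalSubgroup_sub_open_nhds_of_one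
    (isOpen_compl_singleton (x := x)) (fun e : (1 : G) = x => hx e.symm)
  have hxU : x ∉ U.toSubgroup := fun h => hU h rfl
  have : Finite (G ⧸ U.toSubgroup) := U.toOpenSubgroup.toSubgroup.quotient_finite_of_isOpen
    U.toOpenSubgroup.isOpen
  rw [← QuotientGroup.eq_one_iff, ← orderOf_eq_one_iff] at hxU
  obtain ⟨p, hp, hpm⟩ := Nat.exists_prime_and_dvd hxU
  have hn : Nat.card (G ⧸ U.toSubgroup) ≠ 0 := Nat.card_pos.ne'
  -- With `p ^ k` the full `p`-part of the quotient's order, the image of a `p ^ k`-th power has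
  -- order dividing the prime-to-`p` part `r`, although `p` divides that order.
  obtain ⟨k, r, hr, hkr⟩ := Nat.exists_eq_pow_mul_and_not_dvd hn p hp.ne_one
  obtain ⟨z, rfl⟩ := h p hp k
  refine hr (hpm.trans (orderOf_dvd_of_pow_eq_one ?_))
  rw [QuotientGroup.mk_pow, ← pow_mul, ← hkr, pow_card_eq_one']

namespace DihedralAxioms

section

variable (hG : DihedralAxioms G)
include hG

theorem eq_one_of_forall_pow [TotallyDisconnectedSpace G] {x : G} (hx : IsSquare x)
    (h : ∀ p : OddPrime, ∃ z : G, IsSquare z ∧ x = z ^ (p : ℕ)) : x = 1 := by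
  refine eq_one_of_forall_exists_prime_pow fun p hp k => ?_
  rcases hp.eq_two_or_odd' with rfl | hodd
  · have key : ∃ z : G, IsSquare z ∧ x = z ^ 2 ^ k := by
      induction k with
      | zero => exact ⟨x, hx, by simp⟩
      | succ k ih =>
        obtain ⟨z, hz, rfl⟩ := ih
        obtain ⟨w, hw, rfl⟩ := hG.squares.root z hz
        exact ⟨w, hw, by rw [← sq, ← pow_mul, pow_succ']⟩
    exact key.imp fun _ h => h.2
  -- The induction starts at exponent `p`: `pow_pow` improves a `p`-th power to a `p²`-th power, but
  -- does not make every square a `p`-th power.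
  · have key : ∃ z : G, IsSquare z ∧ x = z ^ p ^ (k + 1) := by
      induction k with
      | zero => simpa using h ⟨p, hp, hodd⟩
      | succ k ih =>
        obtain ⟨z, hz, rfl⟩ := ih
        obtain ⟨w, hw, hzw⟩ := (hG.splitAt ⟨p, hp, hodd⟩).pow_pow z hz
        refine ⟨w, hw, ?_⟩
        simp only at hzw
        rw [pow_succ', pow_mul, hzw, ← pow_mul, ← pow_mul, pow_succ', pow_succ']
    obtain ⟨z, -, hz⟩ := key
    exact ⟨z ^ p, by rw [hz, ← pow_mul, pow_succ']⟩

theorem eq_one_of_forall_inComplement [TotallyDisconnectedSpace G] {x : G}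
    (h : ∀ p : OddPrime, InComplement p x) : x = 1 := by
  have conj {z : G} (hz : IsSquare z) : IsSquare (x * z * x⁻¹) := by
    obtain ⟨a, rfl⟩ := hz
    exact ⟨x * a * x⁻¹, by group⟩
  have hinv {z : G} (hz : IsSquare z) : IsSquare z⁻¹ := by
    obtain ⟨a, rfl⟩ := hz
    exact ⟨a⁻¹, by group⟩
  have hsq : IsSquare x := by
    refine hG.squares.isSquare x fun n hn => ?_
    suffices hc : x * n * x⁻¹ * n⁻¹ = 1 by
      rw [mul_inv_eq_one, mul_inv_eq_iff_eq_mul] at hc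
      exact hc
    refine hG.eq_one_of_forall_pow (hG.squares.mul _ _ (conj hn) (hinv hn)) fun p => ?_
    -- Write `n = y * z ^ p` with `y` of order dividing `p`. Since `x` commutes with `y` and squares
    -- commute with each other, `[x, n] = [x, z] ^ p`, and `[x, z]` is again a square.
    obtain ⟨y, z, ⟨hy, hyp⟩, hz, rfl⟩ := (hG.splitAt p).split n hn
    obtain ⟨g, hg, hgx⟩ := h p
    have hxy : Commute x y := by
      rw [hgx]
      exact Commute.pow_left (hg y hy hyp) _
    have hw : IsSquare (x * z * x⁻¹ * z⁻¹) := hG.squares.mul _ _ (conj hz) (hinv hz)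
    refine ⟨_, hw, ?_⟩
    have hcomm : Commute (x * z * x⁻¹) z⁻¹ := hG.squares.comm _ _ (conj hz) (hinv hz)
    have hyw : Commute y ((x * z * x⁻¹ * z⁻¹) ^ (p : ℕ)) :=
      Commute.pow_right (hG.squares.comm _ _ hy hw) _
    calc x * (y * z ^ (p : ℕ)) * x⁻¹ * (y * z ^ (p : ℕ))⁻¹
        = y * ((x * z * x⁻¹) ^ (p : ℕ) * z⁻¹ ^ (p : ℕ)) * y⁻¹ := by
          rw [conj_pow, ← mul_assoc x y, hxy.eq, mul_inv_rev, inv_pow]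
          simp only [mul_assoc]
      _ = (x * z * x⁻¹ * z⁻¹) ^ (p : ℕ) := by
          rw [← hcomm.mul_pow, hyw.eq, mul_inv_cancel_right]
  exact hG.eq_one_of_forall_pow hsq fun p => (hG.splitAt p).inComplement x (h p) hsq

end

theorem injective_projection [TotallyDisconnectedSpace G] (hG : DihedralAxioms G) :
    Function.Injective hG.projection := by
  rw [injective_iff_map_eq_one]
  intro x hx
  exact hG.eq_one_of_forall_inComplement fun p =>
    ((hG.factor p).choose_spec.proj_eq_one_iff (hG.complementMul p)).1 (congrFun hx p)

theorem isOpen_preimage_projection [T2Space G] (hG : DihedralAxioms G) (p : OddPrime)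
    (s : Set (DihedralGroup (p : ℕ))) : IsOpen ((fun g => hG.projection g p) ⁻¹' s) :=
  (hG.factor p).choose_spec.isOpen_preimage (hG.complementMul p) s

/-- The coordinate conditions are closed and any finitely many can be met together, so compactness
meets them all. -/
theorem surjective_projection [T2Space G] (hG : DihedralAxioms G) :
    Function.Surjective hG.projection := by
  intro f
  obtain ⟨g, -, hg⟩ := isCompact_univ.inter_iInter_nonempty
    (fun p : OddPrime => {g : G | hG.projection g p = f p})
    (fun p => (hG.factor p).choose_spec.isClosed_fiber (hG.complementMul p) (f p)) fun s => by
      obtain ⟨g, hg, -⟩ := hG.exists_projection_eq_on_finset f s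
      exact ⟨g, Set.mem_univ _, Set.mem_iInter₂.2 hg⟩
  exact ⟨g, funext fun p => Set.mem_iInter.1 hg p⟩

end DihedralAxioms

end Profinite

/-! ### The theorem for the product itself -/

section DihedralProduct

/-- The coordinate projections of the product of the groups `D_p`. -/
noncomputable def dihedralProductEval (p : OddPrime) : dihedralProduct →* DihedralGroup (p : ℕ) where
  toFun g := g p
  map_one' := rfl
  map_mul' _ _ := rfl

theorem isDihedralProduct_eval : IsDihedralProduct dihedralProductEval :=
  ⟨fun h => funext h, fun f => ⟨f, fun _ => rfl⟩⟩

theorem continuous_to_dihedralProduct {X : Type v} [TopologicalSpace X] {f : X → dihedralProduct}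
    (h : ∀ (p : OddPrime) (s : Set (DihedralGroup (p : ℕ))),
      IsOpen ((fun x => dihedralProductEval p (f x)) ⁻¹' s)) : Continuous f :=
  continuous_pi (A := fun p : OddPrime => ProfiniteGrp.ofFiniteGrp (FiniteGrp.of
    (DihedralGroup (p : ℕ)))) fun p => ⟨fun s _ => h p s⟩

theorem isOpen_preimage_dihedralProductEval (p : OddPrime) (s : Set (DihedralGroup (p : ℕ))) :
    IsOpen (dihedralProductEval p ⁻¹' s) :=
  IsOpen.preimage (t := s) (continuous_apply (A := fun p : OddPrime => ProfiniteGrp.ofFiniteGrp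
    (FiniteGrp.of (DihedralGroup (p : ℕ)))) p) trivial

theorem isAxiomatizable_dihedralProduct : IsAxiomatizable.{0, v} dihedralProduct := by
  intro Δ h
  have hΔ : DihedralAxioms Δ := .of_elementarilyEquivalent isDihedralProduct_eval
    (MulEquiv.ulift (α := dihedralProduct)).symm h
  let f : Δ →* dihedralProduct := hΔ.projection
  have hf : Continuous f := continuous_to_dihedralProduct hΔ.isOpen_preimage_projection
  have hbij : Function.Bijective f := ⟨hΔ.injective_projection, hΔ.surjective_projection⟩
  let e : Δ ≃ₜ* dihedralProduct :=
    { Continuous.homeoOfEquivCompactToT2 (f := Equiv.ofBijective f hbij) hf with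
      map_mul' := map_mul f }
  exact ⟨e.symm⟩

theorem infinite_oddPrime : Infinite OddPrime := by
  have h : {p : ℕ | p.Prime ∧ Odd p} = {p | p.Prime} \ {2} := by
    ext p
    refine and_congr_right fun hp => ⟨?_, hp.eq_two_or_odd'.resolve_left⟩
    rintro hodd (rfl : p = 2)
    exact absurd hodd (by decide)
  have h2 : {p : ℕ | p.Prime ∧ Odd p}.Infinite := by
    rw [h]
    exact Nat.infinite_setOfPred_prime.sdiff (Set.finite_singleton 2)
  exact h2.to_subtype

theorem infinite_index_two_dihedralProduct :
    {U : Subgroup dihedralProduct | IsOpen (U : Set dihedralProduct) ∧ U.index = 2}.Infinite := by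
  have := infinite_oddPrime
  have hsurj (p : OddPrime) : Function.Surjective (dihedralProductEval p) := fun c =>
    (isDihedralProduct_eval.exists_single p c).imp fun _ h => h.1
  refine Set.infinite_of_injective_forall_mem
    (f := fun p : OddPrime => (rotations (p : ℕ)).comap (dihedralProductEval p)) ?_ fun p =>
      ⟨isOpen_preimage_dihedralProductEval p (rotations (p : ℕ)), ?_⟩
  · intro p q hpq
    by_contra hne
    -- A reflection at `p` and 1 elsewhere lies in the subgroup for `q` but not in the one for `p`.
    obtain ⟨x, hx, hx'⟩ := isDihedralProduct_eval.exists_single p (sr 0)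
    have hq : x ∈ (rotations (q : ℕ)).comap (dihedralProductEval q) := by
      rw [Subgroup.mem_comap, hx' q (Ne.symm hne)]
      exact one_mem _
    have hp : x ∈ (rotations (p : ℕ)).comap (dihedralProductEval p) := by
      simp only at hpq
      rwa [hpq]
    rw [Subgroup.mem_comap, hx] at hp
    exact sr_notMem_rotations _ hp
  · rw [Subgroup.index_comap_of_surjective _ (hsurj p), index_rotations]

end DihedralProduct

theorem theorem1p1 :
    IsAxiomatizable.{0, v} dihedralProduct ∧
    {U : Subgroup dihedralProduct |
      IsOpen (U : Set dihedralProduct) ∧ U.index = 2}.Infinite ∧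
    ¬ IsSmallProfinite dihedralProduct ∧
    ¬ (∀ Γ : ProfiniteGrp.{0}, IsAxiomatizable.{0, v} Γ → IsSmallProfinite Γ) := by
  have hsmall : ¬ IsSmallProfinite dihedralProduct := fun h =>
    infinite_index_two_dihedralProduct (h 2 two_pos)
  exact ⟨isAxiomatizable_dihedralProduct, infinite_index_two_dihedralProduct, hsmall,
    fun h => hsmall (h _ isAxiomatizable_dihedralProduct)⟩
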